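/- Let $d\ge 2$, let $\Omega\subset\mathbb R^d$ be bounded and open, let $T:L^{d/(d-1)}(\Omega)\to L^2(\Omega)$ be bounded and linear, $B:=T^*T$, $f\in L^2(\Omega)$, $\mu,\alpha>0$, and let $\alpha_0,\alpha_1\in C(\overline\Omega)$ satisfy $\alpha_0,\alpha_1>\underline\alpha$ on $\Omega$ for some constant $\underline\alpha>0$. Let $r,r^*\in[1,\infty]$ with $1/r+1/r^*=1$; $|\cdot|_r$ is the $\ell^r$ norm of a vector, or of the entries of a matrix, and $|\cdot|=|\cdot|_2$ is the Euclidean (Frobenius) norm. Let $V$ be either the space $\mathcal S^{d\times d}$ of symmetric matrices or $\mathbb R^{d\times d}$. For $(w,u)\in H^1(\Omega,\mathbb R^d)\times H^1(\Omega)$ and $(\psi,\varphi)\in L^2(\Omega,V)\times L^2(\Omega,\mathbb R^d)$ put $$Q_1(w,u)=\tfrac12\|Tu-f\|_{L^2}^2+\tfrac\mu2\|\nabla u\|_{L^2}^2+\tfrac\alpha2\|w\|_{H^1}^2,\quad Q_2(\psi,\varphi)=\int_\Omega\alpha_1|\varphi|_{r^*}\,dx+\int_\Omega\alpha_0|\psi|_{r^*}\,dx,$$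 $$R(w,u)=(Ew,\nabla u-w),\qquad Ew=\tfrac12(\nabla w+\nabla w^\top).$$ The primal problem is to minimize $Q_1(w,u)+Q_2(R(w,u))$ over $H^1(\Omega,\mathbb R^d)\times H^1(\Omega)$. The predual problem is to minimize $Q_1^*(-R^*(p,q))+Q_2^*(p,q)$ over $(p,q)\in L^2(\Omega,V)\times L^2(\Omega,\mathbb R^d)$, where $Q_1^*,Q_2^*$ are the Fenchel conjugates, with values in $[-\infty,\infty]$, and $R^*$ is the adjoint of $R$. Consider the equations $$Bu-\mu\Delta u+\nabla^*q-T^*f=0\ \text{ in } H^1(\Omega)^*,\qquad \alpha w-\alpha\Delta w-q+E^*p=0\ \text{ in } H^1(\Omega,\mathbb R^d)^*,\tag{1}$$ where $\langle-\Delta u,v\rangle=\int_\Omega\nabla u\cdot\nabla v\,dx$, $\langle-\Delta w,\omega\rangle=\int_\Omega\nabla w:\nabla\omega\,dx$, $\langle\nabla^*q,v\rangle=\int_\Omega q\cdot\nabla v\,dx$ and $\langle E^*p,\omega\rangle=\int_\Omega p:E\omega\,dx$. Let $(w,u)\in H^1(\Omega,\mathbb R^d)\times H^1(\Omega)$ and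 $(p,q)\in L^2(\Omega,V)\times L^2(\Omega,\mathbb R^d)$. (a) If $r=2$, then $(w,u)$ solves the primal problem and $(p,q)$ solves the predual problem if and only if (1) holds and, for a.e. $x\in\Omega$, $|q(x)|_r\le\alpha_1(x)$, $|p(x)|_r\le\alpha_0(x)$ and $$\begin{cases}\alpha_1(\nabla u-w)-q|\nabla u-w|=0&\text{if }|q(x)|_r=\alpha_1(x),\\ \nabla u-w=0&\text{if }|q(x)|_r<\alpha_1(x),\end{cases}\qquad \begin{cases}\alpha_0Ew-p|Ew|=0&\text{if }|p(x)|_r=\alpha_0(x),\\ Ew=0&\text{if }|p(x)|_r<\alpha_0(x).\end{cases}$$ (b) For arbitrary $r\in[1,\infty]$ the same equivalence holds with the two equations on the sets $\{|q|_r=\alpha_1\}$ and $\{|p|_r=\alpha_0\}$ replaced by $\alpha_1|\nabla u-w|_{r^*}-q\cdot(\nabla u-w)=0$ and $\alpha_0|Ew|_{r^*}-p:Ew=0$. -/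

import Mathlib

open MeasureTheory
open scoped ENNReal ContDiff

namespace TGV

noncomputable section

/-- `ℝ^d` with the Euclidean norm. -/
abbrev Vec (d : ℕ) := EuclideanSpace ℝ (Fin d)

/-- `ℝ^{d×d}` with the Frobenius inner product and norm; the `(i, j)` entry of `A` is `A (i, j)`. -/
abbrev Mat (d : ℕ) := EuclideanSpace ℝ (Fin d × Fin d)

/-- The space of symmetric `d × d` matrices. -/
def symMat (d : ℕ) : Submodule ℝ (Mat d) where
  carrier := {A | ∀ i j, A (i, j) = A (j, i)}
  add_mem' {A B} hA hB i j := by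
    simp only [PiLp.add_apply]
    rw [hA i j, hB i j]
  zero_mem' i j := rfl
  smul_mem' c A hA i j := by
    simp only [PiLp.smul_apply]
    rw [hA i j]

/-- Symmetric part `(A + Aᵀ) / 2`, as a linear map into `ℝ^{d×d}`. -/
def symPartLin (d : ℕ) : Mat d →ₗ[ℝ] Mat d where
  toFun A := WithLp.toLp 2 (fun ij => (A (ij.1, ij.2) + A (ij.2, ij.1)) / 2)
  map_add' A B := by
    ext ij
    simp only [PiLp.add_apply]
    ring
  map_smul' c A := by
    ext ij
    simp only [PiLp.smul_apply, smul_eq_mul, RingHom.id_apply]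
    ring

theorem symPartLin_mem (d : ℕ) (A : Mat d) : symPartLin d A ∈ symMat d := by
  intro i j
  change (A (i, j) + A (j, i)) / 2 = (A (j, i) + A (i, j)) / 2
  ring

/-- The two choices for the value space of the dual variable `p`:
symmetric matrices, or all matrices. -/
def IsMatrixValueSpace (d : ℕ) (V : Submodule ℝ (Mat d)) : Prop :=
  V = symMat d ∨ V = ⊤

theorem IsMatrixValueSpace.symPartLin_mem {d : ℕ} {V : Submodule ℝ (Mat d)}
    (hV : IsMatrixValueSpace d V) (A : Mat d) : symPartLin d A ∈ V := by
  rcases hV with rfl | rfl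
  · exact TGV.symPartLin_mem d A
  · exact Submodule.mem_top

/-- Symmetric part of a matrix, as a continuous linear map with values in `V`. -/
def symPart {d : ℕ} {V : Submodule ℝ (Mat d)} (hV : IsMatrixValueSpace d V) : Mat d →L[ℝ] V :=
  LinearMap.toContinuousLinearMap ((symPartLin d).codRestrict V hV.symPartLin_mem)

/-- The `ℓ^r` norm of a finite family of reals (of all entries, for a matrix). -/
def lrNorm {ι : Type*} [Fintype ι] (r : ℝ≥0∞) (v : EuclideanSpace ℝ ι) : ℝ :=
  ‖(WithLp.toLp r (WithLp.ofLp v) : PiLp r (fun _ : ι => ℝ))‖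

/-- `L²(Ω, F)`. -/
abbrev L2 {d : ℕ} (Ω : Set (Vec d)) (F : Type*) [NormedAddCommGroup F] :=
  Lp F 2 (volume.restrict Ω)

/-- `g = ∂u/∂xᵢ` weakly in `Ω`. -/
def HasWeakPartial {d : ℕ} (Ω : Set (Vec d)) (i : Fin d) (u g : L2 Ω ℝ) : Prop :=
  ∀ φ : Vec d → ℝ, ContDiff ℝ ∞ φ → HasCompactSupport φ → tsupport φ ⊆ Ω →
    ∫ x in Ω, u x * fderiv ℝ φ x (EuclideanSpace.single i 1) = -∫ x in Ω, g x * φ x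

theorem integrable_mul_of_compactSupport {d : ℕ} {Ω : Set (Vec d)} (u : L2 Ω ℝ) {ψ : Vec d → ℝ}
    (hψ : Continuous ψ) (hc : HasCompactSupport ψ) :
    Integrable (fun x => u x * ψ x) (volume.restrict Ω) :=
  MemLp.integrable_mul (p := 2) (q := 2) (Lp.memLp u) (hψ.memLp_of_hasCompactSupport hc)

theorem continuous_partial {d : ℕ} {φ : Vec d → ℝ} (h : ContDiff ℝ ∞ φ) (v : Vec d) :
    Continuous (fun x => fderiv ℝ φ x v) :=
  (h.continuous_fderiv (by simp)).clm_apply continuous_const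

theorem compactSupport_partial {d : ℕ} {φ : Vec d → ℝ} (h : HasCompactSupport φ) (v : Vec d) :
    HasCompactSupport (fun x => fderiv ℝ φ x v) :=
  h.fderiv_apply (𝕜 := ℝ) v

theorem HasWeakPartial.add {d : ℕ} {Ω : Set (Vec d)} {i : Fin d} {u g u' g' : L2 Ω ℝ}
    (h : HasWeakPartial Ω i u g) (h' : HasWeakPartial Ω i u' g') :
    HasWeakPartial Ω i (u + u') (g + g') := by
  intro φ h1 h2 h3
  have hd := continuous_partial h1 (EuclideanSpace.single i 1)
  have hs := compactSupport_partial h2 (EuclideanSpace.single i 1)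
  have e1 : ∫ x in Ω, (u + u') x * fderiv ℝ φ x (EuclideanSpace.single i 1)
      = ∫ x in Ω, (u x * fderiv ℝ φ x (EuclideanSpace.single i 1)
        + u' x * fderiv ℝ φ x (EuclideanSpace.single i 1)) := by
    refine integral_congr_ae ?_
    filter_upwards [Lp.coeFn_add u u'] with x hx
    rw [hx, Pi.add_apply, add_mul]
  have e2 : ∫ x in Ω, (g + g') x * φ x = ∫ x in Ω, (g x * φ x + g' x * φ x) := by
    refine integral_congr_ae ?_
    filter_upwards [Lp.coeFn_add g g'] with x hx
    rw [hx, Pi.add_apply, add_mul]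
  rw [e1, e2, integral_add (integrable_mul_of_compactSupport u hd hs)
    (integrable_mul_of_compactSupport u' hd hs),
    integral_add (integrable_mul_of_compactSupport g h1.continuous h2)
    (integrable_mul_of_compactSupport g' h1.continuous h2), h φ h1 h2 h3, h' φ h1 h2 h3]
  ring

theorem HasWeakPartial.smul {d : ℕ} {Ω : Set (Vec d)} {i : Fin d} {u g : L2 Ω ℝ} (c : ℝ)
    (h : HasWeakPartial Ω i u g) : HasWeakPartial Ω i (c • u) (c • g) := by
  intro φ h1 h2 h3
  have e1 : ∫ x in Ω, (c • u) x * fderiv ℝ φ x (EuclideanSpace.single i 1)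
      = ∫ x in Ω, c * (u x * fderiv ℝ φ x (EuclideanSpace.single i 1)) := by
    refine integral_congr_ae ?_
    filter_upwards [Lp.coeFn_smul c u] with x hx
    rw [hx, Pi.smul_apply, smul_eq_mul, mul_assoc]
  have e2 : ∫ x in Ω, (c • g) x * φ x = ∫ x in Ω, c * (g x * φ x) := by
    refine integral_congr_ae ?_
    filter_upwards [Lp.coeFn_smul c g] with x hx
    rw [hx, Pi.smul_apply, smul_eq_mul, mul_assoc]
  rw [e1, e2, integral_const_mul, integral_const_mul, h φ h1 h2 h3]
  ring

theorem HasWeakPartial.zero {d : ℕ} {Ω : Set (Vec d)} {i : Fin d} :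
    HasWeakPartial Ω i 0 0 := by
  intro φ h1 h2 h3
  have e (ψ : Vec d → ℝ) : ∫ x in Ω, (0 : L2 Ω ℝ) x * ψ x = 0 := by
    refine integral_eq_zero_of_ae ?_
    filter_upwards [Lp.coeFn_zero ℝ 2 (volume.restrict Ω)] with x hx
    simp only [hx, Pi.zero_apply]
    exact zero_mul _
  rw [e, e, neg_zero]

/-- Component of an `L²` field with values in a Euclidean space. -/
def comp {d : ℕ} {Ω : Set (Vec d)} {ι : Type*} [Fintype ι] (k : ι) :
    L2 Ω (EuclideanSpace ℝ ι) →L[ℝ] L2 Ω ℝ :=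
  (EuclideanSpace.proj k : EuclideanSpace ℝ ι →L[ℝ] ℝ).compLpL 2 (volume.restrict Ω)

/-- `H¹(Ω)`: the pairs `(u, ∇u)` of an `L²` function and its weak gradient in `L²`. -/
def H1 {d : ℕ} (Ω : Set (Vec d)) : Submodule ℝ (L2 Ω ℝ × L2 Ω (Vec d)) where
  carrier := {z | ∀ i, HasWeakPartial Ω i z.1 (comp i z.2)}
  add_mem' {z z'} h h' i := by
    have := (h i).add (h' i)
    rwa [← map_add] at this
  zero_mem' i := by
    have e : comp i (0 : L2 Ω (Vec d)) = 0 := ContinuousLinearMap.map_zero _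
    change HasWeakPartial Ω i 0 (comp i 0)
    rw [e]
    exact HasWeakPartial.zero
  smul_mem' c z h i := by
    have := (h i).smul c
    rwa [← map_smul] at this

/-- `H¹(Ω, ℝ^d)`: the pairs `(w, ∇w)` of an `L²` vector field and its weak Jacobian in `L²`,
`(∇w)_{ij} = ∂wᵢ/∂xⱼ`. -/
def H1Vec {d : ℕ} (Ω : Set (Vec d)) : Submodule ℝ (L2 Ω (Vec d) × L2 Ω (Mat d)) where
  carrier := {z | ∀ i j, HasWeakPartial Ω j (comp i z.1) (comp (i, j) z.2)}
  add_mem' {z z'} h h' i j := by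
    have := (h i j).add (h' i j)
    rwa [← map_add, ← map_add] at this
  zero_mem' i j := by
    have e : comp i (0 : L2 Ω (Vec d)) = 0 := ContinuousLinearMap.map_zero _
    have e' : comp (i, j) (0 : L2 Ω (Mat d)) = 0 := ContinuousLinearMap.map_zero _
    change HasWeakPartial Ω j (comp i 0) (comp (i, j) 0)
    rw [e, e']
    exact HasWeakPartial.zero
  smul_mem' c z h i j := by
    have := (h i j).smul c
    rwa [← map_smul, ← map_smul] at this

variable {d : ℕ} {Ω : Set (Vec d)}

/-- `u ↦ u`, `H¹(Ω) → L²(Ω)`. -/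
def H1.val : H1 Ω →ₗ[ℝ] L2 Ω ℝ := LinearMap.fst ℝ _ _ ∘ₗ (H1 Ω).subtype

/-- `u ↦ ∇u`, `H¹(Ω) → L²(Ω, ℝ^d)`. -/
def H1.grad : H1 Ω →ₗ[ℝ] L2 Ω (Vec d) := LinearMap.snd ℝ _ _ ∘ₗ (H1 Ω).subtype

/-- `w ↦ w`, `H¹(Ω, ℝ^d) → L²(Ω, ℝ^d)`. -/
def H1Vec.val : H1Vec Ω →ₗ[ℝ] L2 Ω (Vec d) := LinearMap.fst ℝ _ _ ∘ₗ (H1Vec Ω).subtype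

/-- `w ↦ ∇w`, `H¹(Ω, ℝ^d) → L²(Ω, ℝ^{d×d})`. -/
def H1Vec.jac : H1Vec Ω →ₗ[ℝ] L2 Ω (Mat d) := LinearMap.snd ℝ _ _ ∘ₗ (H1Vec Ω).subtype

/-- The symmetrized gradient `w ↦ Ew = (∇w + ∇wᵀ)/2`, `H¹(Ω, ℝ^d) → L²(Ω, V)`. -/
def H1Vec.symGrad {V : Submodule ℝ (Mat d)} (hV : IsMatrixValueSpace d V) :
    H1Vec Ω →ₗ[ℝ] L2 Ω V :=
  ((symPart hV).compLpL 2 (volume.restrict Ω)).toLinearMap ∘ₗ H1Vec.jac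

/-- The exponent `d/(d-1) = 1 + 1/(d-1)`. -/
def critExp (d : ℕ) : ℝ≥0∞ := ENNReal.conjExponent d

instance (d : ℕ) : Fact (1 ≤ critExp d) := ⟨le_self_add⟩

theorem critExp_le_two (hd : 2 ≤ d) : critExp d ≤ 2 := by
  have h1 : (1 : ℝ≥0∞) ≤ (d : ℝ≥0∞) - 1 := by
    have h : ((1 : ℕ) : ℝ≥0∞) ≤ ((d - 1 : ℕ) : ℝ≥0∞) := by exact_mod_cast (by omega : 1 ≤ d - 1)
    simpa using h
  have h2 : ((d : ℝ≥0∞) - 1)⁻¹ ≤ 1 := ENNReal.inv_le_one.2 h1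
  calc critExp d = 1 + ((d : ℝ≥0∞) - 1)⁻¹ := rfl
    _ ≤ 1 + 1 := by gcongr
    _ = 2 := one_add_one_eq_two

theorem memLp_critExp (hd : 2 ≤ d) (hΩ : Bornology.IsBounded Ω) (u : L2 Ω ℝ) :
    MemLp u (critExp d) (volume.restrict Ω) := by
  have : IsFiniteMeasure (volume.restrict Ω) := ⟨by
    rw [Measure.restrict_apply_univ]
    exact hΩ.measure_lt_top⟩
  exact (Lp.memLp u).mono_exponent (critExp_le_two hd)

/-- The inclusion of `L²(Ω)` in `L^{d/(d-1)}(Ω)`. -/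
def toCrit (hd : 2 ≤ d) (hΩ : Bornology.IsBounded Ω) :
    L2 Ω ℝ →ₗ[ℝ] Lp ℝ (critExp d) (volume.restrict Ω) where
  toFun u := (memLp_critExp hd hΩ u).toLp u
  map_add' u v := by
    rw [← MemLp.toLp_add]
    exact MemLp.toLp_congr _ _ (Lp.coeFn_add u v)
  map_smul' c u := by
    rw [RingHom.id_apply, ← MemLp.toLp_const_smul]
    exact MemLp.toLp_congr _ _ (Lp.coeFn_smul c u)

/-- The operator `T`, restricted to `H¹(Ω) ⊆ L^{d/(d-1)}(Ω)`. -/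
def opH1 (hd : 2 ≤ d) (hΩ : Bornology.IsBounded Ω)
    (T : Lp ℝ (critExp d) (volume.restrict Ω) →L[ℝ] L2 Ω ℝ) : H1 Ω →ₗ[ℝ] L2 Ω ℝ :=
  T.toLinearMap ∘ₗ toCrit hd hΩ ∘ₗ H1.val

/-! ### The primal problem -/

/-- `R(w, u) = (Ew, ∇u - w)`. -/
def opR {V : Submodule ℝ (Mat d)} (hV : IsMatrixValueSpace d V) :
    (H1Vec Ω × H1 Ω) →ₗ[ℝ] (L2 Ω V × L2 Ω (Vec d)) :=
  LinearMap.prod (H1Vec.symGrad hV ∘ₗ LinearMap.fst ℝ _ _)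
    (H1.grad ∘ₗ LinearMap.snd ℝ _ _ - H1Vec.val ∘ₗ LinearMap.fst ℝ _ _)

/-- `Q₁(w, u) = ½‖Tu - f‖² + (μ/2)‖∇u‖² + (α/2)‖w‖²_{H¹}`. -/
def Q1 (hd : 2 ≤ d) (hΩ : Bornology.IsBounded Ω)
    (T : Lp ℝ (critExp d) (volume.restrict Ω) →L[ℝ] L2 Ω ℝ) (f : L2 Ω ℝ) (μ α : ℝ)
    (z : H1Vec Ω × H1 Ω) : ℝ :=
  1 / 2 * ‖opH1 hd hΩ T z.2 - f‖ ^ 2 + μ / 2 * ‖H1.grad z.2‖ ^ 2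
    + α / 2 * (‖H1Vec.val z.1‖ ^ 2 + ‖H1Vec.jac z.1‖ ^ 2)

/-- `Q₂(ψ, φ) = ∫_Ω α₁ |φ|_s dx + ∫_Ω α₀ |ψ|_s dx`. -/
def Q2 (V : Submodule ℝ (Mat d)) (s : ℝ≥0∞) (α₀ α₁ : Vec d → ℝ) (y : L2 Ω V × L2 Ω (Vec d)) : ℝ :=
  (∫ x in Ω, α₁ x * lrNorm s (y.2 x)) + ∫ x in Ω, α₀ x * lrNorm s (y.1 x : Mat d)

/-- `z = (w, u)` solves the primal problem `min Q₁(w, u) + Q₂(R(w, u))`. -/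
def IsPrimalSolution (hd : 2 ≤ d) (hΩ : Bornology.IsBounded Ω)
    (T : Lp ℝ (critExp d) (volume.restrict Ω) →L[ℝ] L2 Ω ℝ) (f : L2 Ω ℝ) (μ α : ℝ)
    {V : Submodule ℝ (Mat d)} (hV : IsMatrixValueSpace d V) (s : ℝ≥0∞) (α₀ α₁ : Vec d → ℝ)
    (z : H1Vec Ω × H1 Ω) : Prop :=
  ∀ z' : H1Vec Ω × H1 Ω,
    Q1 hd hΩ T f μ α z + Q2 V s α₀ α₁ (opR hV z) ≤ Q1 hd hΩ T f μ α z' + Q2 V s α₀ α₁ (opR hV z')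

/-! ### The predual problem -/

/-- The Fenchel conjugate `F^*(ξ) = sup_x ⟨ξ, x⟩ - F(x)`, with values in `[-∞, ∞]`. -/
def fenchelConj {X : Type*} [AddCommGroup X] [Module ℝ X] (F : X → ℝ) (ξ : X →ₗ[ℝ] ℝ) : EReal :=
  ⨆ x : X, ((ξ x - F x : ℝ) : EReal)

/-- An element of `L²(Ω, V) × L²(Ω, ℝ^d)` as a linear functional on that Hilbert space. -/
def dualOf {V : Submodule ℝ (Mat d)} (y : L2 Ω V × L2 Ω (Vec d)) :
    (L2 Ω V × L2 Ω (Vec d)) →ₗ[ℝ] ℝ :=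
  innerₗ (L2 Ω V) y.1 ∘ₗ LinearMap.fst ℝ _ _ + innerₗ (L2 Ω (Vec d)) y.2 ∘ₗ LinearMap.snd ℝ _ _

/-- The objective `Q₁^*(-R^* y) + Q₂^*(y)` of the predual problem, `y = (p, q)`. -/
def predualEnergy (hd : 2 ≤ d) (hΩ : Bornology.IsBounded Ω)
    (T : Lp ℝ (critExp d) (volume.restrict Ω) →L[ℝ] L2 Ω ℝ) (f : L2 Ω ℝ) (μ α : ℝ)
    {V : Submodule ℝ (Mat d)} (hV : IsMatrixValueSpace d V) (s : ℝ≥0∞) (α₀ α₁ : Vec d → ℝ)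
    (y : L2 Ω V × L2 Ω (Vec d)) : EReal :=
  fenchelConj (Q1 hd hΩ T f μ α) (-(dualOf y ∘ₗ opR hV)) + fenchelConj (Q2 V s α₀ α₁) (dualOf y)

/-- `y = (p, q)` solves the predual problem `min Q₁^*(-R^* y) + Q₂^*(y)`. -/
def IsPredualSolution (hd : 2 ≤ d) (hΩ : Bornology.IsBounded Ω)
    (T : Lp ℝ (critExp d) (volume.restrict Ω) →L[ℝ] L2 Ω ℝ) (f : L2 Ω ℝ) (μ α : ℝ)
    {V : Submodule ℝ (Mat d)} (hV : IsMatrixValueSpace d V) (s : ℝ≥0∞) (α₀ α₁ : Vec d → ℝ)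
    (y : L2 Ω V × L2 Ω (Vec d)) : Prop :=
  ∀ y' : L2 Ω V × L2 Ω (Vec d),
    predualEnergy hd hΩ T f μ α hV s α₀ α₁ y ≤ predualEnergy hd hΩ T f μ α hV s α₀ α₁ y'

/-! ### The operators of the optimality system, with values in `H¹(Ω)^*` and `H¹(Ω, ℝ^d)^*` -/

/-- `T^* g`, as a functional on `H¹(Ω)`. -/
def opTStar (hd : 2 ≤ d) (hΩ : Bornology.IsBounded Ω)
    (T : Lp ℝ (critExp d) (volume.restrict Ω) →L[ℝ] L2 Ω ℝ) (g : L2 Ω ℝ) : H1 Ω →ₗ[ℝ] ℝ :=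
  innerₗ (L2 Ω ℝ) g ∘ₗ opH1 hd hΩ T

/-- `B u = T^* T u`. -/
def opB (hd : 2 ≤ d) (hΩ : Bornology.IsBounded Ω)
    (T : Lp ℝ (critExp d) (volume.restrict Ω) →L[ℝ] L2 Ω ℝ) (u : H1 Ω) : H1 Ω →ₗ[ℝ] ℝ :=
  opTStar hd hΩ T (opH1 hd hΩ T u)

/-- `∇^* q : v ↦ ∫_Ω q · ∇v dx`. -/
def gradStar (q : L2 Ω (Vec d)) : H1 Ω →ₗ[ℝ] ℝ := innerₗ (L2 Ω (Vec d)) q ∘ₗ H1.grad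

/-- `Δ u`, given by `⟨Δu, v⟩ = -∫_Ω ∇u · ∇v dx`. -/
def laplacian (u : H1 Ω) : H1 Ω →ₗ[ℝ] ℝ := -gradStar (H1.grad u)

/-- An `L²` vector field as a functional on `H¹(Ω, ℝ^d)`. -/
def vecFunctional (q : L2 Ω (Vec d)) : H1Vec Ω →ₗ[ℝ] ℝ := innerₗ (L2 Ω (Vec d)) q ∘ₗ H1Vec.val

/-- `Δ w`, given by `⟨Δw, ω⟩ = -∫_Ω ∇w : ∇ω dx`. -/
def laplacianVec (w : H1Vec Ω) : H1Vec Ω →ₗ[ℝ] ℝ :=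
  -(innerₗ (L2 Ω (Mat d)) (H1Vec.jac w) ∘ₗ H1Vec.jac)

/-- `E^* p : ω ↦ ∫_Ω p : Eω dx`. -/
def symGradStar {V : Submodule ℝ (Mat d)} (hV : IsMatrixValueSpace d V) (p : L2 Ω V) :
    H1Vec Ω →ₗ[ℝ] ℝ :=
  innerₗ (L2 Ω V) p ∘ₗ H1Vec.symGrad hV

/-- The two equations
`Bu - μΔu + ∇^*q - T^*f = 0` in `H¹(Ω)^*` and `αw - αΔw - q + E^*p = 0` in `H¹(Ω, ℝ^d)^*`. -/
def OptimalityEquations (hd : 2 ≤ d) (hΩ : Bornology.IsBounded Ω)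
    (T : Lp ℝ (critExp d) (volume.restrict Ω) →L[ℝ] L2 Ω ℝ) (f : L2 Ω ℝ) (μ α : ℝ)
    {V : Submodule ℝ (Mat d)} (hV : IsMatrixValueSpace d V)
    (w : H1Vec Ω) (u : H1 Ω) (p : L2 Ω V) (q : L2 Ω (Vec d)) : Prop :=
  opB hd hΩ T u - μ • laplacian u + gradStar q - opTStar hd hΩ T f = 0 ∧
  α • vecFunctional (H1Vec.val w) - α • laplacianVec w - vecFunctional q + symGradStar hV p = 0

/-- The pointwise conditions linking a dual value `η` with `|η|_r ≤ a` and a primal value `ζ`: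
`aζ - η|ζ| = 0` if `|η|_r = a`, and `ζ = 0` if `|η|_r < a`.
Here `|ζ|` is the Euclidean (Frobenius) norm. -/
def Complementary {ι : Type*} [Fintype ι] (r : ℝ≥0∞) (a : ℝ) (η ζ : EuclideanSpace ℝ ι) : Prop :=
  lrNorm r η ≤ a ∧ (lrNorm r η = a → a • ζ - ‖ζ‖ • η = 0) ∧ (lrNorm r η < a → ζ = 0)

/-- The variant of `Complementary` for a general pair of conjugate exponents `r`, `s`:
`a|ζ|_s - η · ζ = 0` if `|η|_r = a`, and `ζ = 0` if `|η|_r < a`. -/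
def Aligned {ι : Type*} [Fintype ι] (r s : ℝ≥0∞) (a : ℝ) (η ζ : EuclideanSpace ℝ ι) : Prop :=
  lrNorm r η ≤ a ∧ (lrNorm r η = a → a * lrNorm s ζ - inner ℝ η ζ = 0) ∧
    (lrNorm r η < a → ζ = 0)

end

end TGV

/-! `Q1` is a convex quadratic and `Q2` is sublinear, so the pair is optimal exactly when the two
Fenchel–Young inequalities are equalities: `-R^*(p, q)` is the derivative of `Q1` at `(w, u)`, and
`(p, q)` is a subgradient of `Q2` at `R(w, u)`. The first relation is the system of two equations;
the second, localized in `x`, gives the pointwise conditions.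

Sufficiency is weak duality. For necessity (`primal_dual_optimal_iff`) no constraint qualification
is needed. First-order optimality of the primal point gives `-Q1' ≤ Q2 ∘ R`, with equality at that
point. Hahn–Banach turns `-Q1'` into `g ∘ R` with `g ≤ Q2`, and Riesz represents `g` by a predual
variable, because `Q2` is bounded by the `L²` norm. This variable attains the weak duality bound,
hence so does every predual solution.

The pointwise description (`weightedNorm_extremal_iff`) comes from testing with indicator functions.
`aligned_iff` then translates it through the duality of `ℓ^r` and `ℓ^s`, and
`IsMatrixValueSpace.forall_inner_le_iff` handles symmetric matrices. -/

namespace TGV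

/-! ### Duality of the `ℓ^r` and `ℓ^s` norms on finite families -/

section FiniteDimensional

variable {ι : Type*} [Fintype ι]

/-- The identity from the Euclidean space to `ℓ^r`. -/
noncomputable def lrMap (ι : Type*) [Fintype ι] (r : ℝ≥0∞) [Fact (1 ≤ r)] :
    EuclideanSpace ℝ ι →L[ℝ] PiLp r (fun _ : ι => ℝ) :=
  LinearMap.toContinuousLinearMap
    ((WithLp.linearEquiv 2 ℝ (ι → ℝ)).trans (WithLp.linearEquiv r ℝ (ι → ℝ)).symm).toLinearMap

theorem norm_lrMap (r : ℝ≥0∞) [Fact (1 ≤ r)] (v : EuclideanSpace ℝ ι) :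
    ‖lrMap ι r v‖ = lrNorm r v := rfl

theorem lrNorm_one (v : EuclideanSpace ℝ ι) : lrNorm 1 v = ∑ i, |v i| :=
  PiLp.norm_eq_of_L1 _

theorem lrNorm_two (v : EuclideanSpace ℝ ι) : lrNorm 2 v = ‖v‖ := rfl

theorem abs_apply_le_lrNorm_top (v : EuclideanSpace ℝ ι) (i : ι) : |v i| ≤ lrNorm ⊤ v :=
  PiLp.norm_apply_le (WithLp.toLp ⊤ (WithLp.ofLp v) : PiLp ⊤ (fun _ : ι => ℝ)) i

theorem lrNorm_top_le {v : EuclideanSpace ℝ ι} {a : ℝ} (ha : 0 ≤ a) (h : ∀ i, |v i| ≤ a) :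
    lrNorm ⊤ v ≤ a := by
  rw [lrNorm, PiLp.norm_eq_ciSup]
  exact Real.iSup_le h ha

theorem lrNorm_eq_sum {r : ℝ≥0∞} (hr : 0 < r.toReal) (v : EuclideanSpace ℝ ι) :
    lrNorm r v = (∑ i, |v i| ^ r.toReal) ^ (1 / r.toReal) := by
  rw [lrNorm, PiLp.norm_eq_sum hr]
  rfl

theorem lrNorm_nonneg (r : ℝ≥0∞) [Fact (1 ≤ r)] (v : EuclideanSpace ℝ ι) : 0 ≤ lrNorm r v :=
  norm_nonneg _

theorem lrNorm_eq_zero {r : ℝ≥0∞} [Fact (1 ≤ r)] {v : EuclideanSpace ℝ ι} (h : lrNorm r v = 0) :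
    v = 0 := by
  rw [← norm_lrMap, norm_eq_zero] at h
  exact ((WithLp.linearEquiv 2 ℝ (ι → ℝ)).trans
    (WithLp.linearEquiv r ℝ (ι → ℝ)).symm).map_eq_zero_iff.1 h

theorem inner_eq_sum (η v : EuclideanSpace ℝ ι) : inner ℝ η v = ∑ i, η i * v i := by
  simp [PiLp.inner_apply, mul_comm]

theorem inner_le_sum_abs_mul (η v : EuclideanSpace ℝ ι) : inner ℝ η v ≤ ∑ i, |η i| * |v i| := by
  rw [inner_eq_sum]
  exact Finset.sum_le_sum fun i _ => (le_abs_self _).trans (abs_mul _ _).le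

theorem inner_le_lrNorm_one_mul_top (η v : EuclideanSpace ℝ ι) :
    inner ℝ η v ≤ lrNorm 1 η * lrNorm ⊤ v := by
  refine (inner_le_sum_abs_mul η v).trans ?_
  rw [lrNorm_one, Finset.sum_mul]
  exact Finset.sum_le_sum fun i _ =>
    mul_le_mul_of_nonneg_left (abs_apply_le_lrNorm_top v i) (abs_nonneg _)

theorem holderConjugate_cases (r s : ℝ≥0∞) [hrs : r.HolderConjugate s] :
    (r = 1 ∧ s = ⊤) ∨ (r = ⊤ ∧ s = 1) ∨ r.toReal.HolderConjugate s.toReal := by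
  by_cases hr : r = ⊤
  · subst hr
    exact Or.inr (Or.inl ⟨rfl, ENNReal.HolderConjugate.unique ⊤ s 1⟩)
  by_cases hs : s = ⊤
  · subst hs
    exact Or.inl ⟨ENNReal.HolderConjugate.unique ⊤ r 1, rfl⟩
  exact Or.inr (Or.inr (ENNReal.HolderConjugate.toReal_of_ne_top hr hs))

/-- **Hölder's inequality** for the `ℓ^r` norms of finite families. -/
theorem inner_le_lrNorm_mul (r s : ℝ≥0∞) [hrs : r.HolderConjugate s] (η v : EuclideanSpace ℝ ι) :
    inner ℝ η v ≤ lrNorm r η * lrNorm s v := by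
  rcases holderConjugate_cases r s with ⟨rfl, rfl⟩ | ⟨rfl, rfl⟩ | h
  · exact inner_le_lrNorm_one_mul_top η v
  · rw [real_inner_comm, mul_comm]
    exact inner_le_lrNorm_one_mul_top v η
  · rw [lrNorm_eq_sum h.pos, lrNorm_eq_sum h.symm.pos, inner_eq_sum]
    exact Real.inner_le_Lp_mul_Lq Finset.univ η v h

/-- The `ℓ^r` norm is at most the dual norm of the `ℓ^s` norm. -/
theorem lrNorm_le_of_forall_inner_le (r s : ℝ≥0∞) [hrs : r.HolderConjugate s]
    {η : EuclideanSpace ℝ ι} {a : ℝ} (ha : 0 ≤ a)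
    (h : ∀ v : EuclideanSpace ℝ ι, inner ℝ η v ≤ a * lrNorm s v) : lrNorm r η ≤ a := by
  classical
  rcases holderConjugate_cases r s with ⟨rfl, rfl⟩ | ⟨rfl, rfl⟩ | hc
  -- For `r = 1`, the vector of signs of `η` turns the pairing into the sum of the `|η i|`.
  · have h1 := h (WithLp.toLp 2 fun i => (SignType.sign (η i) : ℝ))
    have h2 : lrNorm ⊤ (WithLp.toLp 2 fun i => (SignType.sign (η i) : ℝ)) ≤ 1 := by
      refine lrNorm_top_le zero_le_one fun i => ?_
      rcases lt_trichotomy (η i) 0 with hi | hi | hi <;> simp [hi]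
    rw [inner_eq_sum] at h1
    simp only [self_mul_sign] at h1
    rw [lrNorm_one]
    exact h1.trans ((mul_le_mul_of_nonneg_left h2 ha).trans_eq (mul_one a))
  -- For `r = ∞`, plus and minus a basis vector isolate one entry.
  · refine lrNorm_top_le ha fun i => ?_
    have h1 := h (EuclideanSpace.single i 1)
    have h2 := h (EuclideanSpace.single i (-1))
    rw [lrNorm_one] at h1 h2
    simp only [EuclideanSpace.inner_single_right, PiLp.single_apply] at h1 h2
    rw [Finset.sum_eq_single i (by intro b _ hb; simp [hb]) (by simp)] at h1 h2
    simp at h1 h2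
    exact abs_le'.2 ⟨h1, h2⟩
  -- For finite exponents, `g` attains equality in Hölder for the moduli `|η i|`; the signs of `η`
  -- are put back afterwards.
  · obtain ⟨g, hg, he⟩ :=
      (NNReal.isGreatest_Lp Finset.univ (fun i => ‖η i‖₊) hc).1
    have h1 := h (WithLp.toLp 2 fun i => (SignType.sign (η i) : ℝ) * g i)
    have h2 : lrNorm s (WithLp.toLp 2 fun i => (SignType.sign (η i) : ℝ) * g i) ≤ 1 := by
      rw [lrNorm_eq_sum hc.symm.pos]
      refine Real.rpow_le_one (Finset.sum_nonneg fun i _ => by positivity) ?_ (by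
        have := hc.symm.pos
        positivity)
      refine le_trans (Finset.sum_le_sum fun i _ => ?_)
        (show ∑ i, (g i : ℝ) ^ s.toReal ≤ 1 by exact_mod_cast hg)
      refine Real.rpow_le_rpow (abs_nonneg _) ?_ hc.symm.pos.le
      rcases lt_trichotomy (η i) 0 with hi | hi | hi <;> simp [hi]
    have h3 : lrNorm r η = ∑ i, |η i| * g i := by
      rw [lrNorm_eq_sum hc.pos]
      have := congrArg ((↑) : NNReal → ℝ) he
      push_cast at this
      simpa using this.symm
    rw [inner_eq_sum] at h1
    simp only [← mul_assoc, self_mul_sign] at h1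
    rw [h3]
    exact h1.trans ((mul_le_mul_of_nonneg_left h2 ha).trans_eq (mul_one a))

/-- The bound `|η|_r ≤ a` is a dual-norm bound, and the other two conditions together say that it is
attained at `ζ`. If `|η|_r < a`, Hölder is strict against `a|ζ|_s` unless `ζ = 0`. -/
theorem aligned_iff (r s : ℝ≥0∞) [hrs : r.HolderConjugate s] {a : ℝ} (ha : 0 < a)
    (η ζ : EuclideanSpace ℝ ι) :
    Aligned r s a η ζ ↔
      (∀ v, inner ℝ η v ≤ a * lrNorm s v) ∧ inner ℝ η ζ = a * lrNorm s ζ := by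
  have : Fact (1 ≤ s) := ⟨ENNReal.HolderConjugate.one_le s r⟩
  constructor
  · rintro ⟨h1, h2, h3⟩
    refine ⟨fun v => (inner_le_lrNorm_mul r s η v).trans
      (mul_le_mul_of_nonneg_right h1 (lrNorm_nonneg s v)), ?_⟩
    rcases h1.eq_or_lt with h | h
    · linarith [h2 h]
    · rw [h3 h, ← norm_lrMap]
      simp
  · rintro ⟨h1, h2⟩
    refine ⟨lrNorm_le_of_forall_inner_le r s ha.le h1, fun _ => by linarith, fun h => ?_⟩
    by_contra hζ
    have h0 : 0 < lrNorm s ζ := (lrNorm_nonneg s ζ).lt_of_ne fun h => hζ (lrNorm_eq_zero h.symm)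
    have := inner_le_lrNorm_mul r s η ζ
    nlinarith

/-- On the set where `‖η‖ = a`, this is the equality case of Cauchy–Schwarz. -/
theorem complementary_two_iff {a : ℝ} (η ζ : EuclideanSpace ℝ ι) :
    Complementary 2 a η ζ ↔ Aligned 2 2 a η ζ := by
  unfold Complementary Aligned
  simp only [lrNorm_two]
  refine and_congr_right fun _ => and_congr_left fun _ => imp_congr_right fun h => ?_
  rw [sub_eq_zero, sub_eq_zero, ← h, @eq_comm ℝ, inner_eq_norm_mul_iff_real, eq_comm]

end FiniteDimensional

/-! ### Fenchel duality for a quadratic plus a sublinear function -/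

section ConvexDuality

/-- Divide by `t` and let `t` tend to zero. Only `t < 1` is assumed, so that `1 - t` is a positive
scaling factor in the applications. -/
theorem nonneg_of_forall_quadratic {a b : ℝ}
    (h : ∀ t : ℝ, 0 < t → t < 1 → 0 ≤ t * a + t ^ 2 * b) : 0 ≤ a := by
  by_contra! ha
  have hb : 0 < |b| - a + 1 := by linarith [abs_nonneg b]
  -- This choice gives `t * b ≤ -a / 2`, hence `a + t * b ≤ a / 2 < 0`; the summand `-a + 1` keeps
  -- `t` below `1`.
  set t := -a / (2 * (|b| - a + 1)) with ht
  have ht0 : 0 < t := div_pos (by linarith) (by linarith)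
  have ht1 : t < 1 := (div_lt_one (by linarith)).2 (by linarith [abs_nonneg b])
  have h2 : t * (|b| - a + 1) = -a / 2 := by rw [ht]; field_simp
  have h1 := h t ht0 ht1
  have h3 : t * b ≤ t * (|b| - a + 1) :=
    mul_le_mul_of_nonneg_left (by linarith [le_abs_self b]) ht0.le
  have h4 : t * a + t ^ 2 * b = t * (a + t * b) := by ring
  rw [h4] at h1
  have := nonneg_of_mul_nonneg_right h1 ht0
  linarith

theorem exists_coe_of_add_le_coe {a b : EReal} {c : ℝ} (ha : a ≠ ⊥) (hb : b ≠ ⊥)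
    (h : a + b ≤ (c : EReal)) : ∃ a' b' : ℝ, a = a' ∧ b = b' ∧ a' + b' ≤ c := by
  induction a <;> induction b <;> simp_all
  exact_mod_cast h

variable {X Y : Type*} [AddCommGroup X] [Module ℝ X] [AddCommGroup Y] [Module ℝ Y]

theorem le_fenchelConj (F : X → ℝ) (ξ : X →ₗ[ℝ] ℝ) (x : X) :
    ((ξ x - F x : ℝ) : EReal) ≤ fenchelConj F ξ :=
  le_iSup (fun x : X => ((ξ x - F x : ℝ) : EReal)) x

theorem fenchelConj_ne_bot (F : X → ℝ) (ξ : X →ₗ[ℝ] ℝ) : fenchelConj F ξ ≠ ⊥ :=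
  ((EReal.bot_lt_coe _).trans_le (le_fenchelConj F ξ 0)).ne'

/-- A positively homogeneous subadditive function. -/
structure IsSublinear (N : Y → ℝ) : Prop where
  smul : ∀ c : ℝ, 0 < c → ∀ y, N (c • y) = c * N y
  add_le : ∀ y y', N (y + y') ≤ N y + N y'

/-- `D` and `K` are the linear and the quadratic part of the expansion of `F` at `x`,
and the quadratic part is nonnegative. -/
structure HasQuadraticExpansion (F : X → ℝ) (x : X) (D : X →ₗ[ℝ] ℝ) (K : X → ℝ) : Prop where
  expand : ∀ h, F (x + h) = F x + D h + K h
  smul : ∀ (t : ℝ) h, K (t • h) = t ^ 2 * K h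
  nonneg : ∀ h, 0 ≤ K h

/-- Since the quadratic part is nonnegative, `D` is a subgradient at `x`, so the supremum is
attained there. -/
theorem HasQuadraticExpansion.fenchelConj_eq {F : X → ℝ} {x : X} {D : X →ₗ[ℝ] ℝ} {K : X → ℝ}
    (hF : HasQuadraticExpansion F x D K) : fenchelConj F D = ((D x - F x : ℝ) : EReal) := by
  refine le_antisymm (iSup_le fun y => ?_) (le_fenchelConj F D x)
  rw [EReal.coe_le_coe_iff]
  have h1 := hF.expand (y - x)
  have h2 := hF.nonneg (y - x)
  rw [add_sub_cancel, map_sub] at h1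
  linarith

/-- Equality in Fenchel–Young makes `x` a maximizer of `ξ - F`, so the first-order term `ξ - D`
vanishes in every direction and its opposite. -/
theorem HasQuadraticExpansion.eq_of_fenchelConj_le {F : X → ℝ} {x : X} {D : X →ₗ[ℝ] ℝ} {K : X → ℝ}
    (hF : HasQuadraticExpansion F x D K) {ξ : X →ₗ[ℝ] ℝ}
    (h : fenchelConj F ξ ≤ ((ξ x - F x : ℝ) : EReal)) : ξ = D := by
  have key (y : X) : 0 ≤ D y - ξ y := by
    refine nonneg_of_forall_quadratic (b := K y) fun t _ _ => ?_
    have h1 := (le_fenchelConj F ξ (x + t • y)).trans h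
    rw [EReal.coe_le_coe_iff, hF.expand, hF.smul, map_add, map_smul, map_smul] at h1
    simp only [smul_eq_mul] at h1
    linarith
  ext y
  have h1 := key y
  have h2 := key (-y)
  simp only [map_neg] at h2
  linarith

theorem fenchelConj_eq_zero_of_le {N : Y → ℝ} {ξ : Y →ₗ[ℝ] ℝ}
    (h0 : N 0 = 0) (h : ∀ y, ξ y ≤ N y) : fenchelConj N ξ = 0 := by
  refine le_antisymm (iSup_le fun y => ?_) ?_
  · exact_mod_cast sub_nonpos.2 (h y)
  · simpa [h0] using le_fenchelConj N ξ 0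

theorem IsSublinear.zero {N : Y → ℝ} (hN : IsSublinear N) : N 0 = 0 := by
  have := hN.smul 2 two_pos 0
  rw [smul_zero] at this
  linarith

theorem IsSublinear.le_of_fenchelConj_le {N : Y → ℝ} (hN : IsSublinear N) {ξ : Y →ₗ[ℝ] ℝ} {c : ℝ}
    (h : fenchelConj N ξ ≤ (c : EReal)) (y : Y) : ξ y ≤ N y := by
  by_contra! hlt
  -- Scaled by this factor, the excess `ξ y - N y` becomes `|c| + 1`, which exceeds `c`.
  have hpos : 0 < (|c| + 1) / (ξ y - N y) := by
    apply div_pos (by positivity) (by linarith)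
  have h1 := (le_fenchelConj N ξ (((|c| + 1) / (ξ y - N y)) • y)).trans h
  rw [EReal.coe_le_coe_iff, hN.smul _ hpos, map_smul, smul_eq_mul, ← mul_sub,
    div_mul_cancel₀ _ (by linarith)] at h1
  linarith [le_abs_self c]

/-- A linear functional on `X` that is dominated by `N ∘ A` has the form `g ∘ A` with `g ≤ N`. -/
theorem IsSublinear.exists_comp_eq {N : Y → ℝ} (hN : IsSublinear N) (A : X →ₗ[ℝ] Y)
    (ξ : X →ₗ[ℝ] ℝ) (h : ∀ x, ξ x ≤ N (A x)) :
    ∃ g : Y →ₗ[ℝ] ℝ, g ∘ₗ A = ξ ∧ ∀ y, g y ≤ N y := by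
  -- On the kernel of `A` the bound applied to `x` and `-x` forces `ξ` to vanish, so `ξ` descends to
  -- the range of `A`, where Hahn–Banach applies.
  have hker : LinearMap.ker A ≤ LinearMap.ker ξ := by
    intro x hx
    rw [LinearMap.mem_ker] at hx ⊢
    have h1 := h x
    have h2 := h (-x)
    rw [map_neg, map_neg, hx, neg_zero, hN.zero] at h2
    rw [hx, hN.zero] at h1
    linarith
  let e := A.quotKerEquivRange
  let l : LinearMap.range A →ₗ[ℝ] ℝ := (Submodule.liftQ _ ξ hker) ∘ₗ e.symm.toLinearMap
  have hl (x : X) : l ⟨A x, LinearMap.mem_range_self A x⟩ = ξ x := by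
    have : e.symm ⟨A x, LinearMap.mem_range_self A x⟩ = Submodule.Quotient.mk x := by
      rw [LinearEquiv.symm_apply_eq]
      rfl
    change Submodule.liftQ _ ξ hker (e.symm _) = _
    rw [this]
    rfl
  obtain ⟨g, hg, hgN⟩ := exists_extension_of_le_sublinear ⟨LinearMap.range A, l⟩ N hN.smul hN.add_le
    (by
      rintro ⟨_, x, rfl⟩
      exact (hl x).trans_le (h x))
  refine ⟨g, ?_, hgN⟩
  ext x
  exact (hg ⟨A x, LinearMap.mem_range_self A x⟩).trans (hl x)

/-- Fenchel duality for `F + N ∘ A`, with `F` convex quadratic and `N` sublinear, the dual variables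
being parametrized by `ℓ`: a pair is primal and dual optimal iff it satisfies the extremality
relations. -/
theorem primal_dual_optimal_iff {Z : Type*} {F : X → ℝ} {N : Y → ℝ} {A : X →ₗ[ℝ] Y}
    {ℓ : Z → Y →ₗ[ℝ] ℝ} (hN : IsSublinear N) (hℓ : ∀ g : Y →ₗ[ℝ] ℝ, (∀ y, g y ≤ N y) → ∃ p, ℓ p = g)
    {x : X} {D : X →ₗ[ℝ] ℝ} {K : X → ℝ} (hF : HasQuadraticExpansion F x D K) (p : Z) :
    ((∀ x', F x + N (A x) ≤ F x' + N (A x')) ∧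
      ∀ p', fenchelConj F (-(ℓ p ∘ₗ A)) + fenchelConj N (ℓ p) ≤
        fenchelConj F (-(ℓ p' ∘ₗ A)) + fenchelConj N (ℓ p')) ↔
    (-(ℓ p ∘ₗ A) = D ∧ (∀ y, ℓ p y ≤ N y) ∧ ℓ p (A x) = N (A x)) := by
  have weak (p' : Z) : ((-(ℓ p' (A x)) - F x : ℝ) : EReal) ≤ fenchelConj F (-(ℓ p' ∘ₗ A)) :=
    le_fenchelConj F (-(ℓ p' ∘ₗ A)) x
  constructor
  · rintro ⟨hprim, hdual⟩
    -- First-order condition along `x + t • h`, with `N` estimated by subadditivity.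
    have hD (h : X) : (-D) h ≤ N (A h) := by
      have := nonneg_of_forall_quadratic (a := N (A h) + D h) (b := K h) fun t ht _ => by
        have h1 := hprim (x + t • h)
        have h2 := hN.add_le (A x) (t • A h)
        rw [hF.expand, hF.smul, map_smul, smul_eq_mul, map_add, map_smul] at h1
        rw [hN.smul t ht] at h2
        linarith
      rw [LinearMap.neg_apply]
      linarith
    have hDx : -D x = N (A x) := by
      refine le_antisymm (hD x) ?_
      -- Moving towards the origin scales `A x` by `1 - t > 0`, where homogeneity of `N` is exact.
      have := nonneg_of_forall_quadratic (a := -D x - N (A x)) (b := K x) fun t ht ht1 => by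
        have h1 := hprim (x + (-t) • x)
        have h2 := hN.smul (1 - t) (by linarith) (A x)
        rw [hF.expand, hF.smul, map_smul, smul_eq_mul, map_add, map_smul,
          show A x + -t • A x = (1 - t) • A x by module, h2] at h1
        linarith
      linarith
    -- This builds a dual competitor whose energy is `D x - F x = -N (A x) - F x`, the lower bound
    -- from weak duality.
    obtain ⟨g, hg, hgN⟩ := hN.exists_comp_eq A (-D) hD
    obtain ⟨p', rfl⟩ := hℓ g hgN
    have hle := hdual p'
    rw [fenchelConj_eq_zero_of_le hN.zero hgN, add_zero, hg, neg_neg,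
      hF.fenchelConj_eq] at hle
    have hF1 := weak p
    have hN1 := le_fenchelConj N (ℓ p) (A x)
    have hFbot := fenchelConj_ne_bot F (-(ℓ p ∘ₗ A))
    have hNbot := fenchelConj_ne_bot N (ℓ p)
    have hN0 := le_fenchelConj N (ℓ p) 0
    rw [map_zero, hN.zero, sub_zero, EReal.coe_zero] at hN0
    -- Both conjugates are finite, and finiteness of the second already forces `ℓ p ≤ N`. The upper
    -- bound on `a + b` then leaves no slack in either Fenchel–Young inequality.
    obtain ⟨a, b, ha, hb, hab⟩ := exists_coe_of_add_le_coe hFbot hNbot hle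
    have hNle := hN.le_of_fenchelConj_le hb.le
    rw [ha, EReal.coe_le_coe_iff] at hF1
    rw [hb] at hN1 hN0
    rw [EReal.coe_le_coe_iff] at hN1
    have hb0 : 0 ≤ b := by exact_mod_cast hN0
    have hx := hNle (A x)
    refine ⟨hF.eq_of_fenchelConj_le ?_, hNle, by linarith⟩
    rw [ha, EReal.coe_le_coe_iff]
    simp only [LinearMap.neg_apply, LinearMap.comp_apply]
    linarith
  · rintro ⟨h1, h2, h3⟩
    have e : fenchelConj F (-(ℓ p ∘ₗ A)) + fenchelConj N (ℓ p)
        = ((-N (A x) - F x : ℝ) : EReal) := by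
      rw [fenchelConj_eq_zero_of_le hN.zero h2, add_zero, h1, hF.fenchelConj_eq, ← h1, ← h3]
      rfl
    refine ⟨fun x' => ?_, fun p' => ?_⟩
    · have := le_fenchelConj F (-(ℓ p ∘ₗ A)) x'
      rw [h1, hF.fenchelConj_eq, EReal.coe_le_coe_iff, ← h1] at this
      have h4 := h2 (A x')
      simp only [LinearMap.neg_apply, LinearMap.comp_apply] at this
      linarith
    · rw [e]
      refine le_trans ?_ (add_le_add (weak p') (le_fenchelConj N (ℓ p') (A x)))
      rw [← EReal.coe_add, EReal.coe_le_coe_iff]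
      linarith

end ConvexDuality

/-! ### Weighted `L¹` norms on `L²` and their subdifferentials -/

section IntegralFunctional

variable {X : Type*} [MeasurableSpace X] {ν : Measure X} [IsFiniteMeasure ν]
  {F : Type*} [NormedAddCommGroup F] [InnerProductSpace ℝ F]
  {G : Type*} [NormedAddCommGroup G] [NormedSpace ℝ G]

/-- A bounded, nonnegative weight. -/
structure IsWeight (ν : Measure X) (a : X → ℝ) : Prop where
  meas : AEStronglyMeasurable a ν
  nonneg : ∀ᵐ x ∂ν, 0 ≤ a x
  bdd : ∃ C, ∀ᵐ x ∂ν, ‖a x‖ ≤ C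

/-- The functional `φ ↦ ∫ a |L φ|`. -/
noncomputable def weightedNorm (ν : Measure X) (a : X → ℝ) (L : F →L[ℝ] G) (φ : Lp F 2 ν) : ℝ :=
  ∫ x, a x * ‖L (φ x)‖ ∂ν

theorem integrable_coeFn_Lp_two {F : Type*} [NormedAddCommGroup F] (φ : Lp F 2 ν) : Integrable φ ν :=
  (Lp.memLp φ).integrable one_le_two

theorem integrable_weightedNorm {a : X → ℝ} (ha : IsWeight ν a) (L : F →L[ℝ] G) (φ : Lp F 2 ν) :
    Integrable (fun x => a x * ‖L (φ x)‖) ν := by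
  obtain ⟨C, hC⟩ := ha.bdd
  exact (L.integrable_comp (integrable_coeFn_Lp_two φ)).norm.bdd_mul ha.meas hC

/-- Hölder against the constant `1`, on a finite measure space. -/
theorem integral_norm_le {F : Type*} [NormedAddCommGroup F] (φ : Lp F 2 ν) :
    ∫ x, ‖φ x‖ ∂ν ≤ ‖φ‖ * (ν Set.univ ^ (1 / 2 : ℝ)).toReal := by
  rw [integral_norm_eq_lintegral_enorm (Lp.aestronglyMeasurable φ),
    ← eLpNorm_one_eq_lintegral_enorm, Lp.norm_def, ← ENNReal.toReal_mul]
  refine ENNReal.toReal_mono (ENNReal.mul_ne_top (Lp.eLpNorm_ne_top φ) ?_) ?_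
  · exact ENNReal.rpow_ne_top_of_nonneg (by norm_num) (measure_ne_top ν _)
  · refine (eLpNorm_le_eLpNorm_mul_rpow_measure_univ (one_le_two : (1 : ℝ≥0∞) ≤ 2)
      (Lp.aestronglyMeasurable φ)).trans_eq ?_
    norm_num

theorem weightedNorm_le {a : X → ℝ} (ha : IsWeight ν a) (L : F →L[ℝ] G) :
    ∃ C, ∀ φ : Lp F 2 ν, weightedNorm ν a L φ ≤ C * ‖φ‖ := by
  obtain ⟨C, hC⟩ := ha.bdd
  refine ⟨|C| * ‖L‖ * (ν Set.univ ^ (1 / 2 : ℝ)).toReal, fun φ => ?_⟩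
  calc weightedNorm ν a L φ ≤ ∫ x, |C| * ‖L‖ * ‖φ x‖ ∂ν := by
        refine integral_mono_ae (integrable_weightedNorm ha L φ)
          ((integrable_coeFn_Lp_two φ).norm.const_mul _) ?_
        filter_upwards [hC] with x hx
        rw [mul_assoc]
        exact mul_le_mul ((le_abs_self _).trans (hx.trans (le_abs_self C))) (L.le_opNorm _)
          (norm_nonneg _) (abs_nonneg _)
    _ ≤ _ := by
        rw [integral_const_mul, mul_assoc (|C| * ‖L‖), mul_comm _ ‖φ‖]
        exact mul_le_mul_of_nonneg_left (integral_norm_le φ) (by positivity)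

theorem isSublinear_weightedNorm {a : X → ℝ} (ha : IsWeight ν a) (L : F →L[ℝ] G) :
    IsSublinear (weightedNorm ν a L) where
  smul c hc φ := by
    unfold weightedNorm
    rw [← integral_const_mul]
    refine integral_congr_ae ?_
    filter_upwards [Lp.coeFn_smul c φ] with x hx
    rw [hx, Pi.smul_apply, map_smul, norm_smul, Real.norm_of_nonneg hc.le]
    ring
  add_le φ φ' := by
    unfold weightedNorm
    rw [← integral_add (integrable_weightedNorm ha L φ) (integrable_weightedNorm ha L φ')]
    refine integral_mono_ae (integrable_weightedNorm ha L _)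
      ((integrable_weightedNorm ha L φ).add (integrable_weightedNorm ha L φ')) ?_
    filter_upwards [Lp.coeFn_add φ φ', ha.nonneg] with x hx h0
    rw [hx, Pi.add_apply, map_add, ← mul_add]
    exact mul_le_mul_of_nonneg_left (norm_add_le _ _) h0

/-- Domination at `φ` and `-φ` makes `g` bounded in `L²`, so the Riesz theorem applies. -/
theorem exists_innerₗ_eq [CompleteSpace F] {a : X → ℝ} (ha : IsWeight ν a) (L : F →L[ℝ] G)
    (g : Lp F 2 ν →ₗ[ℝ] ℝ) (hg : ∀ φ, g φ ≤ weightedNorm ν a L φ) :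
    ∃ q, innerₗ (Lp F 2 ν) q = g := by
  obtain ⟨C, hC⟩ := weightedNorm_le (F := F) ha L
  let g' : Lp F 2 ν →L[ℝ] ℝ := g.mkContinuous C fun φ => abs_le'.2
    ⟨(hg φ).trans (hC φ), by
      have := (hg (-φ)).trans (hC (-φ))
      rwa [map_neg, norm_neg] at this⟩
  refine ⟨(InnerProductSpace.toDual ℝ _).symm g', ?_⟩
  ext φ
  exact InnerProductSpace.toDual_symm_apply (𝕜 := ℝ) (x := φ) (y := g')

/-- Testing with `v` times the indicator of a measurable set localizes the inequality for each fixed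
`v`. -/
theorem ae_forall_inner_le [FiniteDimensional ℝ F] {a : X → ℝ} (ha : IsWeight ν a)
    (L : F →L[ℝ] G) (q : Lp F 2 ν) (h : ∀ φ, inner ℝ q φ ≤ weightedNorm ν a L φ) :
    ∀ᵐ x ∂ν, ∀ v, inner ℝ (q x) v ≤ a x * ‖L v‖ := by
  have hv (v : F) : ∀ᵐ x ∂ν, inner ℝ (q x) v ≤ a x * ‖L v‖ := by
    obtain ⟨C, hC⟩ := ha.bdd
    refine ae_le_of_forall_setIntegral_le ((integrable_coeFn_Lp_two q).inner_const v)
      ((Integrable.of_bound ha.meas C hC).mul_const _) fun t ht htf => ?_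
    have h1 := h (indicatorConstLp 2 ht htf.ne v)
    rw [real_inner_comm, L2.inner_indicatorConstLp_eq_setIntegral_inner] at h1
    simp_rw [real_inner_comm]
    refine h1.trans_eq ?_
    rw [weightedNorm, ← integral_indicator ht]
    refine integral_congr_ae ?_
    filter_upwards [indicatorConstLp_coeFn (p := 2) (hs := ht) (hμs := htf.ne) (c := v)]
      with x hx
    rw [hx]
    by_cases hxt : x ∈ t <;> simp [hxt]
  have : ProperSpace F := FiniteDimensional.proper ℝ F
  -- The null set depends on `v`; a countable dense family gives a common one, and continuity in `v`
  -- does the rest.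
  have hd : ∀ᵐ x ∂ν, ∀ n, inner ℝ (q x) (TopologicalSpace.denseSeq F n)
      ≤ a x * ‖L (TopologicalSpace.denseSeq F n)‖ := ae_all_iff.2 fun n => hv _
  filter_upwards [hd] with x hx v
  refine (TopologicalSpace.denseRange_denseSeq F).induction_on
    (p := fun v => inner ℝ (q x) v ≤ a x * ‖L v‖) v ?_ hx
  exact isClosed_le (by fun_prop) (by fun_prop)

theorem inner_le_weightedNorm {a : X → ℝ} (ha : IsWeight ν a)
    (L : F →L[ℝ] G) (q : Lp F 2 ν) (h : ∀ᵐ x ∂ν, ∀ v, inner ℝ (q x) v ≤ a x * ‖L v‖)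
    (φ : Lp F 2 ν) : inner ℝ q φ ≤ weightedNorm ν a L φ := by
  rw [L2.inner_def]
  refine integral_mono_ae (L2.integrable_inner q φ) (integrable_weightedNorm ha L φ) ?_
  filter_upwards [h] with x hx using hx _

/-- The subdifferential of `∫ a |L ·|` is described pointwise. -/
theorem weightedNorm_extremal_iff [FiniteDimensional ℝ F] {a : X → ℝ} (ha : IsWeight ν a)
    (L : F →L[ℝ] G) (q ζ : Lp F 2 ν) :
    ((∀ φ, inner ℝ q φ ≤ weightedNorm ν a L φ) ∧ inner ℝ q ζ = weightedNorm ν a L ζ) ↔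
      ∀ᵐ x ∂ν, (∀ v, inner ℝ (q x) v ≤ a x * ‖L v‖) ∧ inner ℝ (q x) (ζ x) = a x * ‖L (ζ x)‖ := by
  -- The integrands are already ordered, so equal integrals mean equality almost everywhere.
  have key (h : ∀ᵐ x ∂ν, ∀ v, inner ℝ (q x) v ≤ a x * ‖L v‖) :
      inner ℝ q ζ = weightedNorm ν a L ζ ↔
        ∀ᵐ x ∂ν, inner ℝ (q x) (ζ x) = a x * ‖L (ζ x)‖ := by
    rw [L2.inner_def, weightedNorm]
    exact integral_eq_iff_of_ae_le (L2.integrable_inner q ζ) (integrable_weightedNorm ha L ζ)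
      (h.mono fun x hx => hx _)
  rw [Filter.eventually_and]
  constructor
  · rintro ⟨h1, h2⟩
    have h3 := ae_forall_inner_le ha L q h1
    exact ⟨h3, (key h3).1 h2⟩
  · rintro ⟨h1, h2⟩
    exact ⟨inner_le_weightedNorm ha L q h1, (key h1).2 h2⟩

end IntegralFunctional

/-! ### The weights `α₀` and `α₁` on a bounded open set -/

section Weight

variable {d : ℕ} {Ω : Set (Vec d)}

theorem isWeight_of_continuousOn (hΩo : IsOpen Ω) (hΩ : Bornology.IsBounded Ω) {a : Vec d → ℝ}
    (ha : ContinuousOn a (closure Ω)) (hpos : ∀ x ∈ Ω, 0 < a x) :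
    IsWeight (volume.restrict Ω) a where
  meas := (ha.mono subset_closure).aestronglyMeasurable hΩo.measurableSet
  nonneg := (ae_restrict_mem hΩo.measurableSet).mono fun x hx => (hpos x hx).le
  bdd := by
    obtain ⟨C, hC⟩ := hΩ.isCompact_closure.exists_bound_of_continuousOn ha
    exact ⟨C, (ae_restrict_mem hΩo.measurableSet).mono fun x hx => hC x (subset_closure hx)⟩

theorem isFiniteMeasure_restrict (hΩ : Bornology.IsBounded Ω) :
    IsFiniteMeasure (volume.restrict Ω) :=
  ⟨by rw [Measure.restrict_apply_univ]; exact hΩ.measure_lt_top⟩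

end Weight

/-! ### Symmetrization of matrices -/

section SymmetricPart

variable {d : ℕ} {V : Submodule ℝ (Mat d)}

theorem symPartLin_eq (A : Mat d) :
    symPartLin d A = (2⁻¹ : ℝ) • (A + WithLp.toLp 2 fun ij => A (ij.2, ij.1)) := by
  ext ij
  change (A (ij.1, ij.2) + A (ij.2, ij.1)) / 2 = 2⁻¹ * (A ij + A (ij.2, ij.1))
  ring

/-- Transposition permutes the entries, so it is an `ℓ^s` isometry; averaging with it cannot
increase the norm. -/
theorem lrNorm_symPartLin_le (s : ℝ≥0∞) [Fact (1 ≤ s)] (A : Mat d) :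
    lrNorm s (symPartLin d A) ≤ lrNorm s A := by
  have ht : lrNorm s (WithLp.toLp 2 fun ij : Fin d × Fin d => A (ij.2, ij.1)) = lrNorm s A :=
    (LinearIsometryEquiv.piLpCongrLeft s ℝ ℝ (Equiv.prodComm (Fin d) (Fin d))).norm_map
      (WithLp.toLp s (WithLp.ofLp A))
  have hn := norm_add_le (lrMap _ s A) (lrMap _ s (WithLp.toLp 2 fun ij => A (ij.2, ij.1)))
  rw [norm_lrMap, norm_lrMap, ht] at hn
  rw [symPartLin_eq, ← norm_lrMap, map_smul, map_add, norm_smul, Real.norm_of_nonneg (by norm_num)]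
  linarith

theorem inner_symPartLin {η : Mat d} (hη : η ∈ symMat d) (A : Mat d) :
    inner ℝ η (symPartLin d A) = inner ℝ η A := by
  have ht : inner ℝ η (WithLp.toLp 2 fun ij => A (ij.2, ij.1)) = inner ℝ η A := by
    rw [inner_eq_sum, inner_eq_sum, ← (Equiv.prodComm (Fin d) (Fin d)).sum_comp]
    exact Finset.sum_congr rfl fun ij _ => congrArg (· * A ij) (hη ij.2 ij.1)
  rw [symPartLin_eq, real_inner_smul_right, inner_add_right, ht]
  ring

/-- The `ℓ^r` norm of the entries is dual over all matrices, whereas `L²(Ω, V)` tests only with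
values in `V`. Symmetrizing a test matrix keeps its pairing with a symmetric `η` and does not
increase its norm. -/
theorem IsMatrixValueSpace.forall_inner_le_iff (hV : IsMatrixValueSpace d V) (s : ℝ≥0∞)
    [Fact (1 ≤ s)] {a : ℝ} (ha : 0 ≤ a) (η : V) :
    (∀ v : V, inner ℝ η v ≤ a * lrNorm s (v : Mat d)) ↔
      ∀ A : Mat d, inner ℝ (η : Mat d) A ≤ a * lrNorm s A := by
  refine ⟨fun h A => ?_, fun h v => h v⟩
  rcases hV with rfl | rfl
  · have h1 := h ⟨_, TGV.symPartLin_mem d A⟩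
    rw [Submodule.coe_inner, inner_symPartLin η.2] at h1
    exact h1.trans (mul_le_mul_of_nonneg_left (lrNorm_symPartLin_le s A) ha)
  · exact h ⟨A, Submodule.mem_top⟩

end SymmetricPart

/-! ### Rearrangement of linear functionals on a product -/

section LinearAlgebra

theorem coprod_eq_coprod_iff {X Y Z : Type*} [AddCommGroup X] [Module ℝ X] [AddCommGroup Y]
    [Module ℝ Y] [AddCommGroup Z] [Module ℝ Z] {a a' : X →ₗ[ℝ] Z} {b b' : Y →ₗ[ℝ] Z} :
    a.coprod b = a'.coprod b' ↔ a = a' ∧ b = b' := by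
  refine ⟨fun h => ⟨?_, ?_⟩, fun h => by rw [h.1, h.2]⟩
  · simpa using congrArg (· ∘ₗ LinearMap.inl ℝ X Y) h
  · simpa using congrArg (· ∘ₗ LinearMap.inr ℝ X Y) h

variable {X : Type*} [AddCommGroup X] [Module ℝ X]

theorem neg_sub_eq_sub_iff (a b c e : X →ₗ[ℝ] ℝ) : -(a - b) = c - e ↔ c - e - b + a = 0 := by
  rw [eq_comm, ← sub_eq_zero, show c - e - -(a - b) = c - e - b + a by abel]

theorem neg_eq_sub_sub_iff (a b c e : X →ₗ[ℝ] ℝ) : -a = b - c - e ↔ b - c + a - e = 0 := by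
  rw [eq_comm, ← sub_eq_zero, show b - c - e - -a = b - c + a - e by abel]

end LinearAlgebra

/-! ### The extremality relations for `Q1`, `Q2` and `R` -/

section OptimalitySystem

variable {d : ℕ} {Ω : Set (Vec d)} {V : Submodule ℝ (Mat d)}

/-- The derivative of `Q₁` at `(w, u)`. -/
noncomputable def Q1Deriv (hd : 2 ≤ d) (hΩ : Bornology.IsBounded Ω)
    (T : Lp ℝ (critExp d) (volume.restrict Ω) →L[ℝ] L2 Ω ℝ) (f : L2 Ω ℝ) (μ α : ℝ)
    (w : H1Vec Ω) (u : H1 Ω) : (H1Vec Ω × H1 Ω) →ₗ[ℝ] ℝ :=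
  (α • vecFunctional (H1Vec.val w) - α • laplacianVec w).coprod
    (opB hd hΩ T u - μ • laplacian u - opTStar hd hΩ T f)

/-- The quadratic part is `Q1` itself with the datum `f` replaced by zero. -/
theorem hasQuadraticExpansion_Q1 (hd : 2 ≤ d) (hΩ : Bornology.IsBounded Ω)
    (T : Lp ℝ (critExp d) (volume.restrict Ω) →L[ℝ] L2 Ω ℝ) (f : L2 Ω ℝ) {μ α : ℝ}
    (hμ : 0 ≤ μ) (hα : 0 ≤ α) (w : H1Vec Ω) (u : H1 Ω) :
    HasQuadraticExpansion (Q1 hd hΩ T f μ α) (w, u) (Q1Deriv hd hΩ T f μ α w u)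
      (Q1 hd hΩ T 0 μ α) where
  expand := by
    rintro ⟨η, v⟩
    have e1 : opH1 hd hΩ T (u + v) - f = (opH1 hd hΩ T u - f) + opH1 hd hΩ T v := by
      rw [map_add]
      abel
    simp only [Q1, Prod.mk_add_mk, e1]
    simp only [Q1Deriv, map_add, norm_add_sq_real, inner_sub_left,
      LinearMap.coprod_apply, LinearMap.sub_apply, LinearMap.smul_apply, LinearMap.neg_apply,
      laplacian, laplacianVec, vecFunctional, opB, opTStar, gradStar, LinearMap.comp_apply,
      innerₗ_apply_apply, smul_eq_mul, sub_zero]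
    ring
  smul := by
    rintro t ⟨η, v⟩
    simp only [Q1, Prod.smul_mk, map_smul, sub_zero, norm_smul, mul_pow, Real.norm_eq_abs, sq_abs]
    ring
  nonneg h := by
    unfold Q1
    positivity

theorem optimalityEquations_iff (hd : 2 ≤ d) (hΩ : Bornology.IsBounded Ω)
    (T : Lp ℝ (critExp d) (volume.restrict Ω) →L[ℝ] L2 Ω ℝ) (f : L2 Ω ℝ) (μ α : ℝ)
    (hV : IsMatrixValueSpace d V) (w : H1Vec Ω) (u : H1 Ω) (p : L2 Ω V) (q : L2 Ω (Vec d)) :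
    OptimalityEquations hd hΩ T f μ α hV w u p q ↔
      -(dualOf (p, q) ∘ₗ opR hV) = Q1Deriv hd hΩ T f μ α w u := by
  -- The adjoint is split into its `w` and `u` components; `q` enters both, with opposite signs,
  -- because of the entry `∇u - w` of `R`.
  have e : -(dualOf (p, q) ∘ₗ opR hV)
      = (-(symGradStar hV p - vecFunctional q)).coprod (-gradStar q) := by
    refine LinearMap.ext fun z => ?_
    change -(innerₗ _ p (H1Vec.symGrad hV z.1) + innerₗ _ q (H1.grad z.2 - H1Vec.val z.1))
      = -(innerₗ _ p (H1Vec.symGrad hV z.1) - innerₗ _ q (H1Vec.val z.1))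
        + -innerₗ _ q (H1.grad z.2)
    rw [map_sub]
    ring
  rw [e]
  have hw := neg_sub_eq_sub_iff (symGradStar hV p) (vecFunctional q)
    (α • vecFunctional (H1Vec.val w)) (α • laplacianVec w)
  have hu := neg_eq_sub_sub_iff (gradStar q) (opB hd hΩ T u) (μ • laplacian u)
    (opTStar hd hΩ T f)
  exact (and_comm.trans (and_congr hw hu).symm).trans coprod_eq_coprod_iff.symm

theorem isSublinear_Q2 [IsFiniteMeasure (volume.restrict Ω)] (s : ℝ≥0∞) [Fact (1 ≤ s)]
    {α₀ α₁ : Vec d → ℝ} (h₀ : IsWeight (volume.restrict Ω) α₀)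
    (h₁ : IsWeight (volume.restrict Ω) α₁) : IsSublinear (Q2 (Ω := Ω) V s α₀ α₁) where
  smul c hc y := by
    have e₁ := (isSublinear_weightedNorm h₁ (lrMap (Fin d) s)).smul c hc y.2
    have e₀ := (isSublinear_weightedNorm h₀ (lrMap (Fin d × Fin d) s ∘L V.subtypeL)).smul c hc y.1
    refine (congrArg₂ (· + ·) e₁ e₀).trans ?_
    exact (mul_add c _ _).symm
  add_le y y' := by
    have e₁ := (isSublinear_weightedNorm h₁ (lrMap (Fin d) s)).add_le y.2 y'.2
    have e₀ := (isSublinear_weightedNorm h₀ (lrMap (Fin d × Fin d) s ∘L V.subtypeL)).add_le y.1 y'.1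
    exact (add_le_add e₁ e₀).trans_eq (add_add_add_comm _ _ _ _)

theorem Q2_eq (s : ℝ≥0∞) [Fact (1 ≤ s)] (α₀ α₁ : Vec d → ℝ) (y : L2 Ω V × L2 Ω (Vec d)) :
    Q2 V s α₀ α₁ y = weightedNorm (volume.restrict Ω) α₁ (lrMap (Fin d) s) y.2
      + weightedNorm (volume.restrict Ω) α₀ (lrMap (Fin d × Fin d) s ∘L V.subtypeL) y.1 := rfl

/-- Riesz is applied on each factor separately, as each summand of `Q2` vanishes at zero. -/
theorem exists_dualOf_eq [IsFiniteMeasure (volume.restrict Ω)] (s : ℝ≥0∞) [Fact (1 ≤ s)]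
    {α₀ α₁ : Vec d → ℝ} (h₀ : IsWeight (volume.restrict Ω) α₀)
    (h₁ : IsWeight (volume.restrict Ω) α₁) (g : (L2 Ω V × L2 Ω (Vec d)) →ₗ[ℝ] ℝ)
    (hg : ∀ y, g y ≤ Q2 V s α₀ α₁ y) : ∃ y, dualOf y = g := by
  obtain ⟨p, hp⟩ := exists_innerₗ_eq h₀ (lrMap (Fin d × Fin d) s ∘L V.subtypeL)
    (g ∘ₗ LinearMap.inl ℝ _ _) fun φ => by
      have := hg (φ, 0)
      rwa [Q2_eq, (isSublinear_weightedNorm h₁ (lrMap (Fin d) s)).zero, zero_add] at this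
  obtain ⟨q, hq⟩ := exists_innerₗ_eq h₁ (lrMap (Fin d) s)
    (g ∘ₗ LinearMap.inr ℝ _ _) fun φ => by
      have := hg (0, φ)
      rwa [Q2_eq, (isSublinear_weightedNorm h₀
        (lrMap (Fin d × Fin d) s ∘L V.subtypeL)).zero, add_zero] at this
  refine ⟨(p, q), ?_⟩
  refine LinearMap.ext fun z => ?_
  rw [dualOf, hp, hq]
  change g (z.1, 0) + g (0, z.2) = g z
  rw [← map_add, Prod.mk_add_mk, add_zero, zero_add]

theorem dualOf_extremal_iff [IsFiniteMeasure (volume.restrict Ω)] (s : ℝ≥0∞) [Fact (1 ≤ s)]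
    {α₀ α₁ : Vec d → ℝ} (h₀ : IsWeight (volume.restrict Ω) α₀)
    (h₁ : IsWeight (volume.restrict Ω) α₁) (p ψ : L2 Ω V) (q φ : L2 Ω (Vec d)) :
    ((∀ y, dualOf (p, q) y ≤ Q2 V s α₀ α₁ y) ∧ dualOf (p, q) (ψ, φ) = Q2 V s α₀ α₁ (ψ, φ)) ↔
      (∀ᵐ x ∂volume.restrict Ω, (∀ v, inner ℝ (q x) v ≤ α₁ x * lrNorm s v) ∧
        inner ℝ (q x) (φ x) = α₁ x * lrNorm s (φ x)) ∧
      (∀ᵐ x ∂volume.restrict Ω, (∀ v : V, inner ℝ (p x) v ≤ α₀ x * lrNorm s (v : Mat d)) ∧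
        inner ℝ (p x) (ψ x) = α₀ x * lrNorm s (ψ x : Mat d)) := by
  have H₁ := weightedNorm_extremal_iff h₁ (lrMap (Fin d) s) q φ
  have H₀ := weightedNorm_extremal_iff h₀ (lrMap (Fin d × Fin d) s ∘L V.subtypeL) p ψ
  have z₁ := (isSublinear_weightedNorm h₁ (lrMap (Fin d) s)).zero
  have z₀ := (isSublinear_weightedNorm h₀ (lrMap (Fin d × Fin d) s ∘L V.subtypeL)).zero
  have ed (y : L2 Ω V × L2 Ω (Vec d)) : dualOf (p, q) y = inner ℝ p y.1 + inner ℝ q y.2 := rfl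
  refine Iff.trans ?_ (and_congr H₁ H₀)
  simp only [ed, Q2_eq]
  constructor
  · rintro ⟨h, he⟩
    have k₁ (y) := h (0, y)
    have k₀ (y) := h (y, 0)
    have i₀ : inner ℝ p (0 : L2 Ω V) = 0 := inner_zero_right (𝕜 := ℝ) p
    have i₁ : inner ℝ q (0 : L2 Ω (Vec d)) = 0 := inner_zero_right (𝕜 := ℝ) q
    simp only [i₀, i₁, z₀, z₁, zero_add, add_zero] at k₁ k₀
    -- Two inequalities whose sum is an equality are both equalities.
    have := k₁ φ
    have := k₀ ψ
    exact ⟨⟨k₁, by linarith⟩, k₀, by linarith⟩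
  · rintro ⟨⟨k₁, e₁⟩, k₀, e₀⟩
    exact ⟨fun y => by linarith [k₁ y.2, k₀ y.1], by linarith⟩

/-- The extremality relations of the primal and the predual problem. -/
theorem solutions_iff_extremal [IsFiniteMeasure (volume.restrict Ω)] (hd : 2 ≤ d)
    (hΩ : Bornology.IsBounded Ω)
    (T : Lp ℝ (critExp d) (volume.restrict Ω) →L[ℝ] L2 Ω ℝ) (f : L2 Ω ℝ) {μ α : ℝ}
    (hμ : 0 ≤ μ) (hα : 0 ≤ α) (hV : IsMatrixValueSpace d V) (s : ℝ≥0∞) [Fact (1 ≤ s)]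
    {α₀ α₁ : Vec d → ℝ} (h₀ : IsWeight (volume.restrict Ω) α₀)
    (h₁ : IsWeight (volume.restrict Ω) α₁)
    (w : H1Vec Ω) (u : H1 Ω) (p : L2 Ω V) (q : L2 Ω (Vec d)) :
    (IsPrimalSolution hd hΩ T f μ α hV s α₀ α₁ (w, u) ∧
        IsPredualSolution hd hΩ T f μ α hV s α₀ α₁ (p, q)) ↔
      OptimalityEquations hd hΩ T f μ α hV w u p q ∧
      (∀ y, dualOf (p, q) y ≤ Q2 V s α₀ α₁ y) ∧
        dualOf (p, q) (H1Vec.symGrad hV w, H1.grad u - H1Vec.val w)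
          = Q2 V s α₀ α₁ (H1Vec.symGrad hV w, H1.grad u - H1Vec.val w) := by
  rw [optimalityEquations_iff]
  exact primal_dual_optimal_iff (X := H1Vec Ω × H1 Ω) (Y := L2 Ω V × L2 Ω (Vec d))
    (Z := L2 Ω V × L2 Ω (Vec d)) (F := Q1 hd hΩ T f μ α) (N := Q2 V s α₀ α₁) (A := opR hV)
    (ℓ := dualOf) (isSublinear_Q2 s h₀ h₁) (exists_dualOf_eq s h₀ h₁)
    (hasQuadraticExpansion_Q1 hd hΩ T f hμ hα w u) (p, q)

end OptimalitySystem

end TGV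

/-! ### The theorem -/

theorem proposition4p1 {d : ℕ} (hd : 2 ≤ d) {Ω : Set (TGV.Vec d)}
    (hΩo : IsOpen Ω) (hΩ : Bornology.IsBounded Ω)
    (T : Lp ℝ (TGV.critExp d) (volume.restrict Ω) →L[ℝ] TGV.L2 Ω ℝ) (f : TGV.L2 Ω ℝ)
    (α₀ α₁ : TGV.Vec d → ℝ) (hα₀ : ContinuousOn α₀ (closure Ω)) (hα₁ : ContinuousOn α₁ (closure Ω))
    (hpos : ∃ c : ℝ, 0 < c ∧ ∀ x ∈ Ω, c < α₀ x ∧ c < α₁ x)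
    (μ α : ℝ) (hμ : 0 < μ) (hα : 0 < α)
    (r s : ℝ≥0∞) [hrs : r.HolderConjugate s]
    (V : Submodule ℝ (TGV.Mat d)) (hV : TGV.IsMatrixValueSpace d V)
    (w : TGV.H1Vec Ω) (u : TGV.H1 Ω) (p : TGV.L2 Ω V) (q : TGV.L2 Ω (TGV.Vec d)) :
    ((TGV.IsPrimalSolution hd hΩ T f μ α hV s α₀ α₁ (w, u) ∧
        TGV.IsPredualSolution hd hΩ T f μ α hV s α₀ α₁ (p, q)) ↔
      (TGV.OptimalityEquations hd hΩ T f μ α hV w u p q ∧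
        (∀ᵐ x ∂volume.restrict Ω,
          TGV.Aligned r s (α₁ x) (q x) ((TGV.H1.grad u - TGV.H1Vec.val w) x)) ∧
        (∀ᵐ x ∂volume.restrict Ω,
          TGV.Aligned r s (α₀ x) (p x : TGV.Mat d) (TGV.H1Vec.symGrad hV w x : TGV.Mat d)))) ∧
    (r = 2 →
      ((TGV.IsPrimalSolution hd hΩ T f μ α hV s α₀ α₁ (w, u) ∧
          TGV.IsPredualSolution hd hΩ T f μ α hV s α₀ α₁ (p, q)) ↔
        (TGV.OptimalityEquations hd hΩ T f μ α hV w u p q ∧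
          (∀ᵐ x ∂volume.restrict Ω,
            TGV.Complementary r (α₁ x) (q x) ((TGV.H1.grad u - TGV.H1Vec.val w) x)) ∧
          (∀ᵐ x ∂volume.restrict Ω,
            TGV.Complementary r (α₀ x) (p x : TGV.Mat d)
              (TGV.H1Vec.symGrad hV w x : TGV.Mat d))))) := by
  have hs : Fact (1 ≤ s) := ⟨ENNReal.HolderConjugate.one_le s r⟩
  have hfin := TGV.isFiniteMeasure_restrict hΩ
  obtain ⟨c, hc, hαc⟩ := hpos
  have hpos₀ (x) (hx : x ∈ Ω) : 0 < α₀ x := hc.trans (hαc x hx).1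
  have hpos₁ (x) (hx : x ∈ Ω) : 0 < α₁ x := hc.trans (hαc x hx).2
  have h₀ := TGV.isWeight_of_continuousOn hΩo hΩ hα₀ hpos₀
  have h₁ := TGV.isWeight_of_continuousOn hΩo hΩ hα₁ hpos₁
  have hΩae := ae_restrict_mem (μ := volume) hΩo.measurableSet
  have main : (TGV.IsPrimalSolution hd hΩ T f μ α hV s α₀ α₁ (w, u) ∧
        TGV.IsPredualSolution hd hΩ T f μ α hV s α₀ α₁ (p, q)) ↔
      (TGV.OptimalityEquations hd hΩ T f μ α hV w u p q ∧
        (∀ᵐ x ∂volume.restrict Ω,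
          TGV.Aligned r s (α₁ x) (q x) ((TGV.H1.grad u - TGV.H1Vec.val w) x)) ∧
        (∀ᵐ x ∂volume.restrict Ω,
          TGV.Aligned r s (α₀ x) (p x : TGV.Mat d) (TGV.H1Vec.symGrad hV w x : TGV.Mat d))) := by
    rw [TGV.solutions_iff_extremal hd hΩ T f hμ.le hα.le hV s h₀ h₁]
    refine and_congr Iff.rfl ?_
    refine (TGV.dualOf_extremal_iff s h₀ h₁ p (TGV.H1Vec.symGrad hV w) q
      (TGV.H1.grad u - TGV.H1Vec.val w)).trans ?_
    -- The pointwise translation is needed only on `Ω`, where the weights are positive.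
    refine and_congr (Filter.eventually_congr ?_) (Filter.eventually_congr ?_)
    · filter_upwards [hΩae] with x hx
      rw [TGV.aligned_iff r s (hpos₁ x hx)]
    · filter_upwards [hΩae] with x hx
      exact (and_congr (hV.forall_inner_le_iff s (hpos₀ x hx).le (p x)) Iff.rfl).trans
        (TGV.aligned_iff r s (hpos₀ x hx) _ _).symm
  refine ⟨main, ?_⟩
  rintro rfl
  obtain rfl : s = 2 := ENNReal.HolderConjugate.unique 2 s 2
  simpa only [TGV.complementary_two_iff] using main
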